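/- Let $\mathcal H$ be a separable infinite-dimensional complex Hilbert space, and let $\mathcal I$ be a two-sided ideal of $\mathcal B(\mathcal H)$ with $\{0\}\ne\mathcal I\ne\mathcal B(\mathcal H)$, endowed with a norm $\|\cdot\|_{\mathcal I}$ that satisfies $\|ATB\|_{\mathcal I}\le\|A\|\,\|T\|_{\mathcal I}\,\|B\|$ for all $T\in\mathcal I$ and $A,B\in\mathcal B(\mathcal H)$. Assume that $\mathcal I$ is complete and separable with respect to $\|\cdot\|_{\mathcal I}$. Let $\mathcal C$ be a Cartan subalgebra of $\mathcal I$, that is, a maximal element, with respect to inclusion, among the abelian self-adjoint subalgebras of $\mathcal I$. Let $$U_{\mathcal I,\mathcal C}(\mathcal H):=\{W\in\mathcal B(\mathcal H)\mid W \text{ is unitary},\ W-\mathbf 1\in\mathcal I,\ W\mathcal C W^{-1}=\mathcal C\}.$$ Then the complex linear span of $\{WD\mid W\in U_{\mathcal I,\mathcal C}(\mathcal H),\ D\in\mathcal C\}$ is a linear subspace of $\mathcal I$ that is dense in $\mathcal I$ with respect to $\|\cdot\|_{\mathcal I}$. -/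

import Mathlib

noncomputable section

namespace OperatorIdeal

/-- A two-sided ideal of `B(H)` as a complex linear subspace of `B(H)`: it is closed under scalar
multiplication because `c • T = (c • 1) * T`. -/
def toSubmodule {H : Type*} [NormedAddCommGroup H] [InnerProductSpace ℂ H]
    (I : TwoSidedIdeal (H →L[ℂ] H)) : Submodule ℂ (H →L[ℂ] H) where
  carrier := {T | T ∈ I}
  add_mem' := fun ha hb => I.add_mem ha hb
  zero_mem' := I.zero_mem
  smul_mem' := fun c T hT => by
    have h := I.mul_mem_left (c • (1 : H →L[ℂ] H)) T hT
    rwa [smul_mul_assoc, one_mul] at h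

/-- A normed ideal of `B(H)`: a two-sided ideal `I` of `B(H)` with a norm `‖·‖_I` on `I` such that
`‖A T B‖_I ≤ ‖A‖ ‖T‖_I ‖B‖` for all `T ∈ I` and `A, B ∈ B(H)`. -/
structure NormedIdeal (H : Type*) [NormedAddCommGroup H] [InnerProductSpace ℂ H] where
  /-- the underlying two-sided ideal of `B(H)` -/
  ideal : TwoSidedIdeal (H →L[ℂ] H)
  /-- the norm `‖·‖_I`, as a seminorm which by the next field is definite -/
  idealNorm : Seminorm ℂ (toSubmodule ideal)
  eq_zero_of_idealNorm_eq_zero : ∀ T : toSubmodule ideal, idealNorm T = 0 → T = 0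
  idealNorm_mul_mul_le : ∀ (A B : H →L[ℂ] H) (T : toSubmodule ideal),
    idealNorm ⟨A * (T : H →L[ℂ] H) * B, ideal.mul_mem_right _ _ (ideal.mul_mem_left _ _ T.2)⟩
      ≤ ‖A‖ * idealNorm T * ‖B‖

namespace NormedIdeal

/-- The elements of a normed ideal `I`, as a type of its own, so that it carries the norm `‖·‖_I`
and its topology instead of those induced by the operator norm of `B(H)`. -/
def Elem {H : Type*} [NormedAddCommGroup H] [InnerProductSpace ℂ H] (I : NormedIdeal H) : Type _ :=
  toSubmodule I.ideal

/-- An element of `I` as a bounded operator. -/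
def Elem.toOp {H : Type*} [NormedAddCommGroup H] [InnerProductSpace ℂ H] {I : NormedIdeal H}
    (T : I.Elem) : H →L[ℂ] H :=
  (toSubmodule I.ideal).subtype T

instance {H : Type*} [NormedAddCommGroup H] [InnerProductSpace ℂ H] (I : NormedIdeal H) :
    AddCommGroup I.Elem :=
  inferInstanceAs (AddCommGroup (toSubmodule I.ideal))

instance {H : Type*} [NormedAddCommGroup H] [InnerProductSpace ℂ H] (I : NormedIdeal H) :
    Module ℂ I.Elem :=
  inferInstanceAs (Module ℂ (toSubmodule I.ideal))

instance {H : Type*} [NormedAddCommGroup H] [InnerProductSpace ℂ H] (I : NormedIdeal H) :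
    Norm I.Elem :=
  ⟨fun T => I.idealNorm T⟩

theorem core {H : Type*} [NormedAddCommGroup H] [InnerProductSpace ℂ H] (I : NormedIdeal H) :
    NormedSpace.Core ℂ I.Elem where
  norm_nonneg T := apply_nonneg I.idealNorm T
  norm_smul c T := map_smul_eq_mul I.idealNorm c T
  norm_triangle S T := map_add_le_add I.idealNorm S T
  norm_eq_zero_iff T :=
    ⟨I.eq_zero_of_idealNorm_eq_zero T, fun h => by rw [h]; exact map_zero I.idealNorm⟩

instance {H : Type*} [NormedAddCommGroup H] [InnerProductSpace ℂ H] (I : NormedIdeal H) :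
    NormedAddCommGroup I.Elem :=
  NormedAddCommGroup.ofCore I.core

instance {H : Type*} [NormedAddCommGroup H] [InnerProductSpace ℂ H] (I : NormedIdeal H) :
    NormedSpace ℂ I.Elem :=
  NormedSpace.ofCore I.core

end NormedIdeal

/-- `C` is a Cartan subalgebra of the ideal `I` of `B(H)`: a maximal element, with respect to
inclusion, among the abelian self-adjoint (complex) subalgebras of `I`. -/
def IsCartan {H : Type*} [NormedAddCommGroup H] [InnerProductSpace ℂ H] [CompleteSpace H]
    (I : TwoSidedIdeal (H →L[ℂ] H)) (C : NonUnitalStarSubalgebra ℂ (H →L[ℂ] H)) : Prop :=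
  Maximal (fun A : NonUnitalStarSubalgebra ℂ (H →L[ℂ] H) =>
    (∀ X ∈ A, X ∈ I) ∧ ∀ X ∈ A, ∀ Y ∈ A, X * Y = Y * X) C

/-- `U_I(H) = U(H) ∩ (1 + I)`. -/
def unitaryGroup {H : Type*} [NormedAddCommGroup H] [InnerProductSpace ℂ H] [CompleteSpace H]
    (I : TwoSidedIdeal (H →L[ℂ] H)) : Set (H →L[ℂ] H) :=
  {W | W ∈ unitary (H →L[ℂ] H) ∧ W - 1 ∈ I}

/-- The normalizer `U_{I,C}(H) = {W ∈ U_I(H) | W C W⁻¹ = C}`; here `W⁻¹ = W*`. -/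
def normalizer {H : Type*} [NormedAddCommGroup H] [InnerProductSpace ℂ H] [CompleteSpace H]
    (I : TwoSidedIdeal (H →L[ℂ] H)) (C : NonUnitalStarSubalgebra ℂ (H →L[ℂ] H)) :
    Set (H →L[ℂ] H) :=
  {W | W ∈ unitaryGroup I ∧ (fun X => W * X * star W) '' (C : Set (H →L[ℂ] H)) = C}

end OperatorIdeal

end

/-! Separability forces every element of the ideal to be approximable, in the ideal norm, by finite
corners of its matrix in any Hilbert basis (`exists_finset_norm_one_sub_coordProj_lt`): an
uncountable almost disjoint family of index sets yields uncountably many projections and permutation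
unitaries, two of which must nearly agree after multiplication by a given operator. So matrix units
span a dense subspace (`dense_span_of_rankOne_mem`). Since the ideal norm dominates a multiple of
the operator norm, the ideal consists of compact operators. The spectral theorem and maximality then
diagonalize `C`: some Hilbert basis has all its rank-one projections in `C` (`exists_hilbertBasis`).
For that basis, each matrix unit is a reflection swapping two basis vectors times a projection in
`C`, so it lies in the span in question. -/

/-! ### Almost disjoint sets and pigeonhole in separable spaces -/

/-- Identify `ι` with the nodes of the binary tree; `S α` is the set of nodes on the branch `α`.
Distinct branches share only nodes up to the level where they split. -/
theorem exists_almostDisjoint_family (ι : Type*) [Countable ι] [Infinite ι] :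
    ∃ S : (ℕ → Bool) → Set ι, (∀ α, (S α).Infinite) ∧ (∀ α, (S α)ᶜ.Infinite) ∧
      ∀ α β, α ≠ β → (S α ∩ S β).Finite := by
  obtain ⟨e⟩ : Nonempty (List Bool ≃ ι) := nonempty_equiv_of_countable
  let f : (ℕ → Bool) → ℕ → ι := fun α n => e ((List.range n).map α)
  have hf : ∀ {α β m n}, f α m = f β n → m = n := fun h => by
    simpa using congrArg List.length (e.injective h)
  have hinf : ∀ α, (Set.range (f α)).Infinite := fun α =>
    Set.infinite_range_of_injective fun _ _ h => hf h
  have hfin : ∀ α β, α ≠ β → (Set.range (f α) ∩ Set.range (f β)).Finite := by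
    intro α β hne
    obtain ⟨k, hk⟩ := Function.ne_iff.mp hne
    refine ((Set.finite_Iic k).image (f α)).subset ?_
    rintro _ ⟨⟨n, rfl⟩, m, hm⟩
    obtain rfl := hf hm
    refine ⟨m, ?_, rfl⟩
    by_contra hlt
    refine hk ?_
    have h := e.injective hm
    rw [List.map_inj_left] at h
    exact (h k (by simpa using hlt)).symm
  refine ⟨fun α => Set.range (f α), hinf, fun α hcf => ?_, hfin⟩
  -- The opposite branch has almost all of its nodes outside `S α`.
  have hne : α ≠ fun n => !(α n) := fun h => by simpa using congrFun h 0
  refine hinf (fun n => !(α n)) ((hcf.union (hfin _ _ hne)).subset fun x hx => ?_)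
  by_cases hxα : x ∈ Set.range (f α)
  · exact Or.inr ⟨hxα, hx⟩
  · exact Or.inl hxα

theorem uncountable_nat_arrow_bool : Uncountable (ℕ → Bool) := by
  by_contra h
  rw [not_uncountable_iff] at h
  obtain ⟨f, hf⟩ := exists_surjective_nat (ℕ → Bool)
  obtain ⟨n, hn⟩ := hf fun k => !(f k k)
  simpa using congrFun hn n

/-- Pigeonhole: two indices must choose the same nearby term of a dense sequence. -/
theorem exists_ne_norm_sub_lt {α E : Type*} [Uncountable α] [SeminormedAddCommGroup E]
    [TopologicalSpace.SeparableSpace E] (f : α → E) {ε : ℝ} (hε : 0 < ε) :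
    ∃ a b, a ≠ b ∧ ‖f a - f b‖ < ε := by
  have h : ∀ a, ∃ n : ℕ, dist (f a) (TopologicalSpace.denseSeq E n) < ε / 2 := fun a => by
    simpa using (TopologicalSpace.denseRange_denseSeq E).exists_dist_lt (f a) (half_pos hε)
  choose n hn using h
  have hninj : ¬ Function.Injective n := fun hi => not_countable hi.countable
  simp only [Function.Injective, not_forall] at hninj
  obtain ⟨a, b, hab, hne⟩ := hninj
  refine ⟨a, b, hne, ?_⟩
  rw [← dist_eq_norm]
  have hb := hn b
  rw [← hab] at hb
  linarith [dist_triangle_right (f a) (f b) (TopologicalSpace.denseSeq E (n a)), hn a]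

theorem exists_perm_apply_mem_iff {ι : Type*} [Countable ι] {s t : Set ι} (hs : s.Infinite)
    (hs' : sᶜ.Infinite) (ht : t.Infinite) (ht' : tᶜ.Infinite) :
    ∃ σ : Equiv.Perm ι, ∀ i, σ i ∈ t ↔ i ∈ s := by
  classical
  have := hs.to_subtype
  have := hs'.to_subtype
  have := ht.to_subtype
  have := ht'.to_subtype
  obtain ⟨e⟩ : Nonempty (s ≃ t) := nonempty_equiv_of_countable
  obtain ⟨e'⟩ : Nonempty ((sᶜ : Set ι) ≃ (tᶜ : Set ι)) := nonempty_equiv_of_countable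
  refine ⟨Equiv.subtypeCongr (p := (· ∈ s)) (q := (· ∈ t)) e e', fun i => ?_⟩
  by_cases hi : i ∈ s
  · simp [Equiv.subtypeCongr, hi]
  · have h : (e' ⟨i, hi⟩ : ι) ∉ t := (e' ⟨i, hi⟩).2
    simp only [hi, iff_false]
    simpa [Equiv.subtypeCongr, hi, Equiv.sumCompl_symm_apply_of_neg] using h

theorem Orthonormal.countable {𝕜 H ι : Type*} [RCLike 𝕜] [NormedAddCommGroup H]
    [InnerProductSpace 𝕜 H] [TopologicalSpace.SeparableSpace H] {v : ι → H}
    (hv : Orthonormal 𝕜 v) : Countable ι := by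
  by_contra hc
  rw [not_countable_iff] at hc
  obtain ⟨i, j, hij, h⟩ := exists_ne_norm_sub_lt v one_pos
  have h1 : ‖v i - v j‖ * ‖v i - v j‖ = 1 + 1 := by
    rw [@norm_sub_mul_self 𝕜, hv.inner_eq_zero hij, hv.norm_eq_one i, hv.norm_eq_one j]
    norm_num
  nlinarith [norm_nonneg (v i - v j)]

/-! ### Coordinate projections, permutation unitaries and finite approximation -/

namespace HilbertBasis

variable {ι H : Type*} [NormedAddCommGroup H] [InnerProductSpace ℂ H]

theorem infinite_index (b : HilbertBasis ι ℂ H) (hH : ¬ FiniteDimensional ℂ H) : Infinite ι := by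
  by_contra h
  rw [not_infinite_iff_finite] at h
  have := Fintype.ofFinite ι
  exact hH b.toOrthonormalBasis.toBasis.finiteDimensional_of_finite

theorem clm_ext (b : HilbertBasis ι ℂ H) {A B : H →L[ℂ] H} (h : ∀ i, A (b i) = B (b i)) :
    A = B :=
  ContinuousLinearMap.ext_on (s := Set.range b)
    (Submodule.dense_iff_topologicalClosure_eq_top.mpr b.dense_span) fun _ ⟨i, hi⟩ => hi ▸ h i

variable [CompleteSpace H]

/-- The orthogonal projection onto the closed span of the basis vectors with index in `S`. -/
noncomputable def coordProj (b : HilbertBasis ι ℂ H) (S : Set ι) : H →L[ℂ] H :=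
  (Submodule.span ℂ (b '' S)).topologicalClosure.starProjection

open Classical in
theorem coordProj_apply (b : HilbertBasis ι ℂ H) (S : Set ι) (i : ι) :
    b.coordProj S (b i) = if i ∈ S then b i else 0 := by
  unfold coordProj
  split_ifs with hi
  · exact Submodule.starProjection_eq_self_iff.mpr
      (Submodule.le_topologicalClosure _ (Submodule.subset_span ⟨i, hi, rfl⟩))
  · rw [Submodule.starProjection_apply_eq_zero_iff, Submodule.orthogonal_closure,
      Submodule.mem_orthogonal]
    intro u hu
    induction hu using Submodule.span_induction with
    | mem x hx =>
      obtain ⟨j, hj, rfl⟩ := hx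
      exact b.orthonormal.inner_eq_zero fun h => hi (h ▸ hj)
    | zero => simp
    | add x y _ _ hx hy => rw [inner_add_left, hx, hy, add_zero]
    | smul c x _ hx => rw [inner_smul_left, hx, mul_zero]

theorem norm_coordProj_le (b : HilbertBasis ι ℂ H) (S : Set ι) : ‖b.coordProj S‖ ≤ 1 :=
  Submodule.starProjection_norm_le _

theorem star_coordProj (b : HilbertBasis ι ℂ H) (S : Set ι) :
    star (b.coordProj S) = b.coordProj S :=
  isSelfAdjoint_starProjection _

theorem coordProj_finset (b : HilbertBasis ι ℂ H) (F : Finset ι) :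
    b.coordProj F = ∑ i ∈ F, InnerProductSpace.rankOne ℂ (b i) (b i) := by
  classical
  refine b.clm_ext fun j => ?_
  simp [coordProj_apply, orthonormal_iff_ite.mp b.orthonormal]

/-- The unitary operator that permutes the basis vectors by `σ`. -/
noncomputable def permOp (b : HilbertBasis ι ℂ H) (σ : Equiv.Perm ι) : H →L[ℂ] H :=
  let c : HilbertBasis ι ℂ H := HilbertBasis.mk (b.orthonormal.comp σ σ.injective) (by
    rw [σ.surjective.range_comp, b.dense_span])
  (b.repr.trans c.repr.symm).toContinuousLinearEquiv

theorem permOp_apply (b : HilbertBasis ι ℂ H) (σ : Equiv.Perm ι) (i : ι) :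
    b.permOp σ (b i) = b (σ i) := by
  classical
  simp [permOp, HilbertBasis.repr_self, HilbertBasis.repr_symm_single]

theorem norm_permOp_le (b : HilbertBasis ι ℂ H) (σ : Equiv.Perm ι) : ‖b.permOp σ‖ ≤ 1 :=
  ContinuousLinearMap.opNorm_le_bound _ zero_le_one fun x => by
    simp [permOp]

/-- A separable seminorm on `B(H)` that is compatible with left multiplication is small on the
orthogonal complements of large finite sets of basis vectors. -/
theorem exists_finset_norm_one_sub_coordProj_lt [Countable ι] [Infinite ι]
    (b : HilbertBasis ι ℂ H) {E : Type*} [SeminormedAddCommGroup E]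
    [TopologicalSpace.SeparableSpace E] (Φ : (H →L[ℂ] H) →+ E)
    (hΦ : ∀ B A, ‖Φ (B * A)‖ ≤ ‖B‖ * ‖Φ A‖) {ε : ℝ} (hε : 0 < ε) :
    ∃ F : Finset ι, ‖Φ (1 - b.coordProj F)‖ < ε := by
  classical
  have hle : ∀ {B} A, ‖B‖ ≤ 1 → ‖Φ (B * A)‖ ≤ ‖Φ A‖ := fun A hB =>
    (hΦ _ A).trans (mul_le_of_le_one_left (norm_nonneg _) hB)
  obtain ⟨S, hS, hS', hSS⟩ := exists_almostDisjoint_family ι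
  have := uncountable_nat_arrow_bool
  have hδ : 0 < ε / 3 := by positivity
  obtain ⟨α, β, hαβ, h1⟩ := exists_ne_norm_sub_lt (fun α => Φ (b.coordProj (S α))) hδ
  set A : Set ι := S α \ S β with hA
  have hAinf : A.Infinite := fun h => hS α
    ((h.union (hSS α β hαβ)).subset fun x hx => by
      by_cases hx' : x ∈ S β
      · exact Or.inr ⟨hx, hx'⟩
      · exact Or.inl ⟨hx, hx'⟩)
  have hAinf' : Aᶜ.Infinite := (hS' α).mono (Set.compl_subset_compl.mpr Set.sdiff_subset)
  have hΦA : ‖Φ (b.coordProj A)‖ < ε / 3 := by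
    -- Left multiplication by a contraction passes from the small difference to the projection onto
    -- an infinite, co-infinite set.
    have hEq : b.coordProj A = b.coordProj A * (b.coordProj (S α) - b.coordProj (S β)) := by
      refine b.clm_ext fun i => ?_
      simp only [mul_apply_eq_comp, sub_apply, coordProj_apply,
        hA, Set.mem_sdiff]
      by_cases h1 : i ∈ S α <;> by_cases h2 : i ∈ S β <;> simp [h1, h2, coordProj_apply]
    rw [hEq]
    refine (hle _ (b.norm_coordProj_le A)).trans_lt ?_
    rwa [map_sub]
  -- Each `σ γ` carries `Aᶜ` onto `S γ`; a second pigeonhole, on the unitaries, then controls almost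
  -- all of `Aᶜ`.
  choose σ hσ using fun γ => exists_perm_apply_mem_iff hAinf' (by rwa [compl_compl]) (hS γ) (hS' γ)
  obtain ⟨γ, η, hγη, h2⟩ := exists_ne_norm_sub_lt (fun γ => Φ (b.permOp (σ γ))) hδ
  set R : Set ι := {i | σ γ i ∈ S γ \ S η} with hR
  have hΦR : ‖Φ (b.coordProj R)‖ < ε / 3 + ε / 3 := by
    set Q := b.permOp (σ γ)⁻¹ * b.coordProj (S γ \ S η) with hQ
    have hQ1 : ‖Q‖ ≤ 1 := (norm_mul_le _ _).trans
      (mul_le_one₀ (b.norm_permOp_le _) (norm_nonneg _) (b.norm_coordProj_le _))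
    -- The projection onto `R` is `Q * b.permOp (σ γ)`. Replacing `γ` by `η` leaves an operator that
    -- kills every basis vector indexed by `Aᶜ`, since `σ η` sends `Aᶜ` into `S η`; hence the factor
    -- `b.coordProj A`.
    have hE1 : b.coordProj R = Q * (b.permOp (σ γ) - b.permOp (σ η)) +
        (Q * b.permOp (σ η)) * b.coordProj A := by
      have hE2 : (Q * b.permOp (σ η)) * b.coordProj A = Q * b.permOp (σ η) := by
        refine b.clm_ext fun i => ?_
        simp only [mul_apply_eq_comp, coordProj_apply, hQ]
        split_ifs with hi
        · rfl
        · have : σ η i ∈ S η := (hσ η i).mpr hi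
          simp [permOp_apply, coordProj_apply, this]
      rw [hE2, mul_sub, sub_add_cancel]
      refine b.clm_ext fun i => ?_
      simp only [mul_apply_eq_comp, coordProj_apply, hQ, permOp_apply, hR,
        Set.mem_ofPred_eq]
      split_ifs <;> simp [permOp_apply]
    rw [hE1, map_add]
    refine (norm_add_le _ _).trans_lt (add_lt_add_of_lt_of_le ?_ ?_)
    · refine (hle _ hQ1).trans_lt ?_
      rwa [map_sub]
    · refine (hle _ ?_).trans hΦA.le
      exact (norm_mul_le _ _).trans (mul_le_one₀ hQ1 (norm_nonneg _) (b.norm_permOp_le _))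
  -- Outside `A ∪ R`, `σ γ` takes values in the finite set `S γ ∩ S η`.
  have hfin : ((A ∪ R)ᶜ).Finite := by
    refine ((hSS γ η hγη).preimage (σ γ).injective.injOn).subset fun i hi => ?_
    rw [Set.mem_compl_iff, Set.mem_union, not_or] at hi
    have hγ : σ γ i ∈ S γ := (hσ γ i).mpr hi.1
    exact ⟨hγ, by_contra fun h => hi.2 ⟨hγ, h⟩⟩
  refine ⟨hfin.toFinset, ?_⟩
  have hsum : 1 - b.coordProj (hfin.toFinset : Set ι) = b.coordProj A + b.coordProj R := by
    refine b.clm_ext fun i => ?_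
    have hdisj : i ∈ R → i ∉ A := fun h => (hσ γ i).mp h.1
    simp only [sub_apply, add_apply, coordProj_apply,
      Set.Finite.coe_toFinset, Set.mem_compl_iff, Set.mem_union, one_apply_eq_self]
    by_cases h1 : i ∈ R
    · simp [h1, hdisj h1]
    · by_cases h2 : i ∈ A <;> simp [h1, h2]
  rw [hsum, map_add]
  linarith [norm_add_le (Φ (b.coordProj A)) (Φ (b.coordProj R))]

end HilbertBasis

/-! ### Density of matrix units and compactness in a separable normed ideal -/

namespace OperatorIdeal.NormedIdeal

open InnerProductSpace

variable {H : Type*} [NormedAddCommGroup H] [InnerProductSpace ℂ H] {I : NormedIdeal H}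

/-- The inclusion of a normed ideal into `B(H)`, as a linear map. -/
noncomputable def toOpLinear (I : NormedIdeal H) : I.Elem →ₗ[ℂ] (H →L[ℂ] H) :=
  (toSubmodule I.ideal).subtype

/-- An operator in the ideal as an element of the normed ideal. -/
def ofMem (I : NormedIdeal H) (T : H →L[ℂ] H) (hT : T ∈ I.ideal) : I.Elem :=
  (⟨T, hT⟩ : toSubmodule I.ideal)

theorem toOpLinear_apply (T : I.Elem) : I.toOpLinear T = T.toOp := rfl

theorem toOp_ofMem (T : H →L[ℂ] H) (hT : T ∈ I.ideal) : (I.ofMem T hT).toOp = T := rfl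

theorem toOp_mem (T : I.Elem) : T.toOp ∈ I.ideal :=
  (show toSubmodule I.ideal from T).2

theorem toOpLinear_injective : Function.Injective I.toOpLinear :=
  (toSubmodule I.ideal).injective_subtype

theorem norm_le_mul_of_toOp_eq {A B : H →L[ℂ] H} {S T : I.Elem} (h : S.toOp = A * T.toOp * B) :
    ‖S‖ ≤ ‖A‖ * ‖T‖ * ‖B‖ := by
  have hS : S = I.ofMem (A * T.toOp * B)
      (I.ideal.mul_mem_right _ _ (I.ideal.mul_mem_left _ _ (toOp_mem T))) :=
    toOpLinear_injective h
  rw [hS]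
  exact I.idealNorm_mul_mul_le A B T

theorem rankOne_mem (hI : I.ideal ≠ ⊥) (u v : H) : rankOne ℂ u v ∈ I.ideal := by
  obtain ⟨T, hT, hT0⟩ : ∃ T ∈ I.ideal, T ≠ 0 := by
    by_contra! h
    refine hI (TwoSidedIdeal.ext fun T => ⟨fun hT => ?_, fun hT => ?_⟩)
    · rw [h T hT]
      exact zero_mem _
    · rw [(TwoSidedIdeal.mem_bot _).mp hT]
      exact zero_mem _
  obtain ⟨x, hx⟩ : ∃ x, T x ≠ 0 := by
    by_contra! h
    exact hT0 (ContinuousLinearMap.ext h)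
  have hEq : rankOne ℂ u v =
      ((inner ℂ (T x) (T x))⁻¹ • rankOne ℂ u (T x)) * T * rankOne ℂ x v := by
    have hne : inner ℂ (T x) (T x) ≠ 0 := inner_self_ne_zero.mpr hx
    ext z
    simp only [mul_apply_eq_comp, rankOne_apply, map_smul, smul_apply, smul_smul]
    rw [inv_mul_cancel₀ hne, mul_one]
  rw [hEq]
  exact I.ideal.mul_mem_right _ _ (I.ideal.mul_mem_left _ _ hT)

/-- Sandwiching `T` between rank-one operators turns it into `‖T y‖ ^ 2` times a fixed rank-one
projection `E`, so `K = ‖E‖⁻¹` works. -/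
theorem exists_norm_toOp_le (hI : I.ideal ≠ ⊥) : ∃ K : ℝ, ∀ T : I.Elem, ‖T.toOp‖ ≤ K * ‖T‖ := by
  rcases subsingleton_or_nontrivial H with hH | hH
  · refine ⟨0, fun T => ?_⟩
    rw [Subsingleton.elim T.toOp 0]
    simp
  obtain ⟨e, he⟩ := exists_norm_eq H zero_le_one
  set E : I.Elem := I.ofMem (rankOne ℂ e e) (rankOne_mem hI e e) with hE
  have hE0 : 0 < ‖E‖ := by
    rw [norm_pos_iff]
    intro h
    have h' : rankOne ℂ e e = 0 := by
      have := congrArg I.toOpLinear h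
      rwa [map_zero] at this
    rw [rankOne_eq_zero, or_self] at h'
    simp [h'] at he
  refine ⟨‖E‖⁻¹, fun T => ContinuousLinearMap.opNorm_le_bound _ (by positivity) fun y => ?_⟩
  have hkey : ‖inner ℂ (T.toOp y) (T.toOp y) • E‖ ≤ ‖T.toOp y‖ * ‖T‖ * ‖y‖ := by
    have h : (inner ℂ (T.toOp y) (T.toOp y) • E).toOp =
        rankOne ℂ e (T.toOp y) * T.toOp * rankOne ℂ y e := by
      rw [← toOpLinear_apply, map_smul, toOpLinear_apply, hE, toOp_ofMem]
      ext z
      simp only [mul_apply_eq_comp, rankOne_apply, map_smul, smul_apply, smul_smul, mul_comm]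
    refine (norm_le_mul_of_toOp_eq h).trans_eq ?_
    simp [he]
  rw [norm_smul, inner_self_eq_norm_sq_to_K, norm_pow, RCLike.norm_ofReal, abs_norm] at hkey
  rcases eq_or_lt_of_le (norm_nonneg (T.toOp y)) with h0 | h0
  · rw [← h0]
    positivity
  · rw [mul_assoc, inv_mul_eq_div, le_div_iff₀ hE0]
    refine le_of_mul_le_mul_left ?_ h0
    calc ‖T.toOp y‖ * (‖T.toOp y‖ * ‖E‖) = ‖T.toOp y‖ ^ 2 * ‖E‖ := by ring
      _ ≤ _ := hkey
      _ = _ := by ring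

variable [CompleteSpace H]

section Approximation

variable {ι : Type*} [Countable ι] [Infinite ι] [TopologicalSpace.SeparableSpace I.Elem]

theorem exists_finset_norm_lt_left (b : HilbertBasis ι ℂ H) (T : I.Elem) {ε : ℝ} (hε : 0 < ε) :
    ∃ F : Finset ι, ∀ S : I.Elem, S.toOp = (1 - b.coordProj F) * T.toOp → ‖S‖ < ε := by
  let Φ : (H →L[ℂ] H) →+ I.Elem := AddMonoidHom.mk'
    (fun A => I.ofMem (A * T.toOp) (I.ideal.mul_mem_left _ _ (toOp_mem T)))
    fun A B => toOpLinear_injective (add_mul A B T.toOp)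
  have hΦ : ∀ A, (Φ A).toOp = A * T.toOp := fun A => rfl
  obtain ⟨F, hF⟩ := b.exists_finset_norm_one_sub_coordProj_lt Φ (fun B A => by
    have h : (Φ (B * A)).toOp = B * (Φ A).toOp * 1 := by rw [hΦ, hΦ, mul_one, mul_assoc]
    refine (norm_le_mul_of_toOp_eq h).trans ?_
    exact mul_le_of_le_one_right (by positivity) ContinuousLinearMap.norm_id_le) hε
  refine ⟨F, fun S hS => ?_⟩
  rwa [show S = Φ (1 - b.coordProj F) from toOpLinear_injective hS]

theorem exists_finset_norm_lt_right (b : HilbertBasis ι ℂ H) (T : I.Elem) {ε : ℝ} (hε : 0 < ε) :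
    ∃ F : Finset ι, ∀ S : I.Elem, S.toOp = T.toOp * (1 - b.coordProj F) → ‖S‖ < ε := by
  -- The adjoint converts right multiplication into the left compatibility required of `Φ`; the map
  -- is only conjugate linear, so additivity is what is used.
  let Φ : (H →L[ℂ] H) →+ I.Elem := AddMonoidHom.mk'
    (fun A => I.ofMem (T.toOp * star A) (I.ideal.mul_mem_right _ _ (toOp_mem T)))
    fun A B => toOpLinear_injective (by
      rw [map_add]
      exact (congrArg (T.toOp * ·) (star_add A B)).trans (mul_add _ _ _))
  have hΦ : ∀ A, (Φ A).toOp = T.toOp * star A := fun A => rfl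
  obtain ⟨F, hF⟩ := b.exists_finset_norm_one_sub_coordProj_lt Φ (fun B A => by
    have h : (Φ (B * A)).toOp = 1 * (Φ A).toOp * star B := by
      rw [hΦ, hΦ, one_mul, star_mul, mul_assoc]
    refine (norm_le_mul_of_toOp_eq h).trans ?_
    rw [norm_star, mul_comm]
    exact mul_le_mul_of_nonneg_left (mul_le_of_le_one_left (norm_nonneg _)
      ContinuousLinearMap.norm_id_le) (norm_nonneg _)) hε
  refine ⟨F, fun S hS => ?_⟩
  rwa [show S = Φ (1 - b.coordProj F) from toOpLinear_injective (hS.trans (by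
    rw [toOpLinear_apply, hΦ, star_sub, star_one, b.star_coordProj]))]

/-- In a separable normed ideal, the matrix units of any Hilbert basis span a dense subspace. -/
theorem dense_span_of_rankOne_mem (b : HilbertBasis ι ℂ H) (V : Submodule ℂ I.Elem)
    (hV : ∀ i j, ∀ S : I.Elem, S.toOp = rankOne ℂ (b i) (b j) → S ∈ V) (hI : I.ideal ≠ ⊥) :
    Dense (V : Set I.Elem) := by
  intro T
  rw [Metric.mem_closure_iff]
  intro ε hε
  obtain ⟨F, hF⟩ := exists_finset_norm_lt_left b T (half_pos hε)
  obtain ⟨G, hG⟩ := exists_finset_norm_lt_right b T (half_pos hε)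
  let R : I.Elem := ∑ i ∈ F, ∑ j ∈ G,
    inner ℂ (b i) (T.toOp (b j)) • I.ofMem (rankOne ℂ (b i) (b j)) (rankOne_mem hI _ _)
  have hR : R.toOp = b.coordProj F * T.toOp * b.coordProj G := by
    simp only [R, ← toOpLinear_apply, map_sum, map_smul, HilbertBasis.coordProj_finset,
      Finset.sum_mul, Finset.mul_sum]
    rw [Finset.sum_comm]
    refine Finset.sum_congr rfl fun i _ => Finset.sum_congr rfl fun j _ => ?_
    ext z
    simp [toOpLinear_apply, toOp_ofMem, mul_apply_eq_comp, smul_smul, mul_comm]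
  refine ⟨R, Submodule.sum_mem _ fun i _ => Submodule.sum_mem _ fun j _ =>
    Submodule.smul_mem _ _ (hV i j _ rfl), ?_⟩
  let S₁ := I.ofMem ((1 - b.coordProj F) * T.toOp) (I.ideal.mul_mem_left _ _ (toOp_mem T))
  let S₂ := I.ofMem (T.toOp * (1 - b.coordProj G)) (I.ideal.mul_mem_right _ _ (toOp_mem T))
  -- With `P`, `Q` the projections for `F`, `G`: `T - P T Q = (1 - P) T + P T (1 - Q)`.
  let S₃ := I.ofMem (b.coordProj F * S₂.toOp) (I.ideal.mul_mem_left _ _ (toOp_mem S₂))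
  have h1 : ‖S₁‖ < ε / 2 := hF S₁ rfl
  have h2 : ‖S₃‖ < ε / 2 := by
    have h : S₃.toOp = b.coordProj F * S₂.toOp * 1 := (mul_one _).symm
    refine (norm_le_mul_of_toOp_eq h).trans_lt (lt_of_le_of_lt ?_ (hG S₂ rfl))
    exact (mul_le_of_le_one_right (by positivity) ContinuousLinearMap.norm_id_le).trans
      (mul_le_of_le_one_left (norm_nonneg _) (b.norm_coordProj_le _))
  have hsum : T - R = S₁ + S₃ := by
    refine toOpLinear_injective ?_
    simp only [map_sub, map_add, toOpLinear_apply, hR, S₁, S₂, S₃, toOp_ofMem]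
    noncomm_ring
  rw [dist_eq_norm, hsum]
  linarith [norm_add_le S₁ S₃]

end Approximation

/-- Finite-rank operators are dense in the ideal norm, which controls the operator norm, and compact
operators are norm closed. -/
theorem isCompactOperator_toOp [TopologicalSpace.SeparableSpace H]
    [TopologicalSpace.SeparableSpace I.Elem] (hH : ¬ FiniteDimensional ℂ H) (hI : I.ideal ≠ ⊥)
    (T : I.Elem) : IsCompactOperator T.toOp := by
  obtain ⟨w, b, -⟩ := exists_hilbertBasis ℂ H
  have := b.orthonormal.countable
  have := b.infinite_index hH
  obtain ⟨K, hK⟩ := exists_norm_toOp_le hI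
  let V : Submodule ℂ I.Elem :=
    (compactOperator (RingHom.id ℂ) H H).comap I.toOpLinear
  have hcont : Continuous I.toOpLinear := AddMonoidHomClass.continuous_of_bound I.toOpLinear K hK
  have hclosed : IsClosed (V : Set I.Elem) :=
    isClosed_setOfPred_isCompactOperator.preimage hcont
  have hdense : Dense (V : Set I.Elem) := dense_span_of_rankOne_mem b V (fun i j S hS => by
    change IsCompactOperator S.toOp
    rw [hS, rankOne_def']
    exact (isCompactOperator_of_locallyCompactSpace_rng
      (ContinuousLinearMap.toSpanSingleton ℂ (b i))).comp_clm _) hI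
  exact hclosed.closure_subset (hdense T)

end OperatorIdeal.NormedIdeal

/-! ### Diagonalization of a Cartan subalgebra -/

namespace OperatorIdeal

open InnerProductSpace

variable {H : Type*} [NormedAddCommGroup H] [InnerProductSpace ℂ H]

/-- A commuting family of operators has a joint eigenvector in every nonzero finite-dimensional
invariant subspace. -/
theorem exists_joint_eigenvector {s : Set (H →L[ℂ] H)} (hs : ∀ X ∈ s, ∀ Y ∈ s, X * Y = Y * X)
    (V : Submodule ℂ H) [FiniteDimensional ℂ V] (hV : V ≠ ⊥) (hinv : ∀ X ∈ s, ∀ x ∈ V, X x ∈ V) :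
    ∃ v ∈ V, v ≠ 0 ∧ ∀ X ∈ s, ∃ c : ℂ, X v = c • v := by
  induction hn : Module.finrank ℂ V using Nat.strong_induction_on generalizing V with
  | _ n ih =>
  by_cases hscalar : ∀ X ∈ s, ∃ c : ℂ, ∀ x ∈ V, X x = c • x
  · obtain ⟨v, hv, hv0⟩ := Submodule.exists_mem_ne_zero_of_ne_bot hV
    exact ⟨v, hv, hv0, fun X hX => (hscalar X hX).imp fun c hc => hc v hv⟩
  · push Not at hscalar
    obtain ⟨X, hX, hXne⟩ := hscalar
    have := Submodule.nontrivial_iff_ne_bot.mpr hV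
    obtain ⟨c, hc⟩ := Module.End.exists_eigenvalue
      ((X : H →ₗ[ℂ] H).restrict (p := V) (q := V) (hinv X hX))
    obtain ⟨x, hx⟩ := hc.exists_hasEigenvector
    have hXx : X x = c • (x : H) := congrArg Subtype.val hx.apply_eq_smul
    let V' : Submodule ℂ H := V ⊓ Module.End.eigenspace (X : H →ₗ[ℂ] H) c
    have hV' : ∀ y, y ∈ V' ↔ y ∈ V ∧ X y = c • y := fun y => by
      simp [V']
    have hle : V' ≤ V := inf_le_left
    have hlt : V' < V := by
      refine lt_of_le_of_ne hle fun h => ?_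
      obtain ⟨y, hy, hne⟩ := hXne c
      exact hne ((hV' y).mp (h ▸ hy)).2
    have := Submodule.finiteDimensional_of_le hle
    obtain ⟨v, hv, hv0, hev⟩ := ih _ (hn ▸ Submodule.finrank_lt_finrank_of_lt hlt) V'
      (fun h => hx.2 (Subtype.ext ((Submodule.eq_bot_iff _).mp h x ((hV' x).mpr ⟨x.2, hXx⟩))))
      (fun Y hY y hy => by
        obtain ⟨hyV, hyX⟩ := (hV' y).mp hy
        refine (hV' _).mpr ⟨hinv Y hY y hyV, ?_⟩
        rw [← mul_apply_eq_comp, hs X hX Y hY, mul_apply_eq_comp, hyX, map_smul]) rfl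
    exact ⟨v, hle hv, hv0, hev⟩

variable [CompleteSpace H] {I : TwoSidedIdeal (H →L[ℂ] H)} {C : NonUnitalStarSubalgebra ℂ (H →L[ℂ] H)}

namespace IsCartan

/-- Adjoining `Z` to `C` gives an abelian self-adjoint subalgebra of `I`, so maximality absorbs it.
-/
theorem mem_of_commute (hC : IsCartan I C) {Z : H →L[ℂ] H} (hZ : Z ∈ I) (hZs : star Z = Z)
    (hcomm : ∀ X ∈ C, Z * X = X * Z) : Z ∈ C := by
  have hsC : ∀ x ∈ insert Z (C : Set (H →L[ℂ] H)), star x ∈ insert Z (C : Set (H →L[ℂ] H)) := by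
    rintro x (rfl | hx)
    · exact Or.inl hZs
    · exact Or.inr (star_mem hx)
  have hcom : ∀ x ∈ insert Z (C : Set (H →L[ℂ] H)), ∀ y ∈ insert Z (C : Set (H →L[ℂ] H)),
      x * y = y * x := by
    rintro x (rfl | hx) y (rfl | hy)
    · rfl
    · exact hcomm y hy
    · exact (hcomm x hx).symm
    · exact hC.1.2 x hx y hy
  let A := NonUnitalStarAlgebra.adjoin ℂ (insert Z (C : Set (H →L[ℂ] H)))
  have hA : (∀ X ∈ A, X ∈ I) ∧ ∀ X ∈ A, ∀ Y ∈ A, X * Y = Y * X := by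
    constructor
    · intro X hX
      -- Carrying `star X` along makes the star case of the induction immediate.
      have h : X ∈ I ∧ star X ∈ I := by
        induction hX using NonUnitalStarAlgebra.adjoin_induction with
        | mem x hx =>
          have hmem : ∀ y ∈ insert Z (C : Set (H →L[ℂ] H)), y ∈ I := by
            rintro y (rfl | hy)
            · exact hZ
            · exact hC.1.1 y hy
          exact ⟨hmem x hx, hmem _ (hsC x hx)⟩
        | add x y _ _ hx hy => exact ⟨add_mem hx.1 hy.1, star_add x y ▸ add_mem hx.2 hy.2⟩
        | zero => exact ⟨zero_mem _, (star_zero (H →L[ℂ] H)).symm ▸ zero_mem _⟩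
        | mul x y _ _ hx hy =>
          exact ⟨I.mul_mem_left _ _ hy.1, star_mul x y ▸ I.mul_mem_left _ _ hx.2⟩
        | smul r x _ hx =>
          exact ⟨(toSubmodule I).smul_mem r hx.1,
            star_smul r x ▸ (toSubmodule I).smul_mem (star r) hx.2⟩
        | star x _ hx => exact ⟨hx.2, (star_star x).symm ▸ hx.1⟩
      exact h.1
    · have := NonUnitalStarAlgebra.isMulCommutative_adjoin ℂ hcom
        fun a ha b hb => hcom a ha _ (hsC b hb)
      exact fun X hX Y hY => setLike_mul_comm hX hY
  exact hC.2 hA (fun x hx => NonUnitalStarAlgebra.subset_adjoin ℂ _ (Or.inr hx))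
    (NonUnitalStarAlgebra.subset_adjoin ℂ _ (Or.inl rfl))

/-- As `v` is an eigenvector of both `X` and `star X`, with conjugate eigenvalues if `v ≠ 0`,
`rankOne ℂ v v` commutes with `C`. -/
theorem rankOne_mem_of_eigenvector (hC : IsCartan I C) {v : H} (hv : rankOne ℂ v v ∈ I)
    (hev : ∀ X ∈ C, ∃ c : ℂ, X v = c • v) : rankOne ℂ v v ∈ C := by
  refine hC.mem_of_commute hv (adjoint_rankOne v v) fun X hX => ?_
  obtain ⟨c, hc⟩ := hev X hX
  obtain ⟨d, hd⟩ := hev (star X) (star_mem hX)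
  have hd' : ContinuousLinearMap.adjoint X v = d • v := hd
  rcases eq_or_ne v 0 with rfl | hv0
  · simp
  have hcd : (starRingEnd ℂ) d = c := by
    have h := ContinuousLinearMap.adjoint_inner_left X v v
    rw [hc, hd', inner_smul_left, inner_smul_right] at h
    exact mul_right_cancel₀ (inner_self_ne_zero.mpr hv0) h
  ext z
  simp only [mul_apply_eq_comp, rankOne_apply, map_smul, hc]
  rw [← ContinuousLinearMap.adjoint_inner_left, hd', inner_smul_left, hcd, smul_smul, mul_comm]

/-- Every nonzero closed subspace invariant under a Cartan subalgebra of compact operators contains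
a joint eigenvector. -/
theorem exists_joint_eigenvector_of_isCompactOperator (hC : IsCartan I C)
    (hcompact : ∀ X ∈ I, IsCompactOperator X) (K : Submodule ℂ H) [CompleteSpace K] (hK : K ≠ ⊥)
    (hinv : ∀ X ∈ C, ∀ x ∈ K, X x ∈ K) :
    ∃ v ∈ K, v ≠ 0 ∧ ∀ X ∈ C, ∃ c : ℂ, X v = c • v := by
  -- If the self-adjoint elements vanish on `K`, so does `C`. Otherwise one of them has a nonzero
  -- eigenvalue on `K`, whose eigenspace is finite-dimensional and `C`-invariant.
  by_cases hzero : ∀ X ∈ C, star X = X → ∀ x ∈ K, X x = 0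
  · obtain ⟨v, hv, hv0⟩ := Submodule.exists_mem_ne_zero_of_ne_bot hK
    refine ⟨v, hv, hv0, fun X hX => ⟨0, ?_⟩⟩
    rw [zero_smul]
    have h1 := hzero (X + star X) (add_mem hX (star_mem hX)) (by simp [add_comm]) v hv
    have h2 := hzero (Complex.I • (X - star X))
      (SMulMemClass.smul_mem _ (sub_mem hX (star_mem hX))) (by
        rw [star_smul, star_sub, star_star, ← neg_sub X, smul_neg, ← neg_smul]
        simp) v hv
    rw [smul_apply, smul_eq_zero_iff_right Complex.I_ne_zero, sub_apply, sub_eq_zero] at h2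
    rw [add_apply, ← h2, ← two_smul ℂ] at h1
    exact (smul_eq_zero_iff_right two_ne_zero).mp h1
  · push Not at hzero
    obtain ⟨X, hX, hXs, x, hxK, hx⟩ := hzero
    have hXc := hcompact X (hC.1.1 X hX)
    have hsymm : (X : H →ₗ[ℂ] H).IsSymmetric := ContinuousLinearMap.isSelfAdjoint_iff_isSymmetric.mp hXs
    let S : K →L[ℂ] K := X.restrict (hinv X hX)
    have hSc : IsCompactOperator S := hXc.restrict' (hinv X hX)
    have hSs : S.IsSymmetric := hsymm.restrict_invariant (hinv X hX)
    have hS0 : S ≠ 0 := fun h => hx (by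
      have := congrArg (fun A : K →L[ℂ] K => (A ⟨x, hxK⟩ : H)) h
      exact this)
    rw [Ne, ← ContinuousLinearMap.eq_zero_of_forall_hasEigenvalue_eq_zero hSc hSs] at hS0
    push Not at hS0
    obtain ⟨μ, hμ, hμ0⟩ := hS0
    obtain ⟨y, hy⟩ := hμ.exists_hasEigenvector
    have hXy : X y = μ • (y : H) := congrArg Subtype.val hy.apply_eq_smul
    let V : Submodule ℂ H := K ⊓ Module.End.eigenspace (X : H →ₗ[ℂ] H) μ
    have hV : ∀ z, z ∈ V ↔ z ∈ K ∧ X z = μ • z := fun z => by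
      simp [V]
    have := ContinuousLinearMap.finite_dimensional_eigenspace hXc μ hμ0
    have : FiniteDimensional ℂ V := Submodule.finiteDimensional_of_le
      (S₂ := Module.End.eigenspace (X : H →ₗ[ℂ] H) μ) inf_le_right
    obtain ⟨v, hv, hv0, hev⟩ := exists_joint_eigenvector (s := C) hC.1.2 V
      (fun h => hy.2 (Subtype.ext ((Submodule.eq_bot_iff _).mp h y ((hV y).mpr ⟨y.2, hXy⟩))))
      (fun Y hY z hz => by
        obtain ⟨hzK, hzX⟩ := (hV z).mp hz
        refine (hV _).mpr ⟨hinv Y hY z hzK, ?_⟩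
        rw [← mul_apply_eq_comp, hC.1.2 X hX Y hY, mul_apply_eq_comp, hzX, map_smul])
    exact ⟨v, ((hV v).mp hv).1, hv0, hev⟩

/-- A Cartan subalgebra of an ideal of compact operators containing the operators of rank one
contains the coordinate projections of some Hilbert basis. -/
theorem exists_hilbertBasis (hC : IsCartan I C) (hcompact : ∀ X ∈ I, IsCompactOperator X)
    (hrank : ∀ v : H, rankOne ℂ v v ∈ I) :
    ∃ (w : Set H) (b : HilbertBasis w ℂ H), ∀ i, rankOne ℂ (b i) (b i) ∈ C := by
  obtain ⟨w, hw⟩ := zorn_subset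
    {s : Set H | Orthonormal ℂ ((↑) : s → H) ∧ ∀ v ∈ s, rankOne ℂ v v ∈ C} fun c hc cc =>
      ⟨⋃₀ c, ⟨orthonormal_sUnion_of_directed cc.directedOn fun s hs => (hc hs).1,
        fun v ⟨s, hs, hv⟩ => (hc hs).2 v hv⟩, fun _ => Set.subset_sUnion_of_mem⟩
  obtain ⟨⟨hwo, hwC⟩, hmax⟩ := hw
  have hperp : (Submodule.span ℂ (Set.range ((↑) : w → H)))ᗮ = ⊥ := by
    rw [Subtype.range_coe]
    by_contra hne
    have hmem : ∀ x, x ∈ (Submodule.span ℂ w)ᗮ ↔ ∀ u ∈ w, inner ℂ u x = 0 := fun x => by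
      refine ⟨fun h u hu => (Submodule.mem_orthogonal _ _).mp h u (Submodule.subset_span hu),
        fun h => (Submodule.mem_orthogonal _ _).mpr fun u hu => ?_⟩
      induction hu using Submodule.span_induction with
      | mem u hu => exact h u hu
      | zero => simp
      | add u v _ _ hu hv => rw [inner_add_left, hu, hv, add_zero]
      | smul c u _ hu => rw [inner_smul_left, hu, mul_zero]
    -- The orthogonal complement is invariant: `star X` commutes with each `rankOne ℂ u u`, so `u`
    -- is an eigenvector of `star X`.
    obtain ⟨v, hv, hv0, hev⟩ := hC.exists_joint_eigenvector_of_isCompactOperator hcompact _ hne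
      (fun X hX x hx => (hmem _).mpr fun u hu => by
        have hu1 : inner ℂ u u = 1 := by
          rw [inner_self_eq_norm_sq_to_K, hwo.norm_eq_one ⟨u, hu⟩]
          simp
        have hcomm := congrArg (fun A : H →L[ℂ] H => A u)
          (hC.1.2 _ (star_mem hX) _ (hwC u hu))
        simp only [mul_apply_eq_comp, rankOne_apply, hu1, one_smul] at hcomm
        have hadj : ContinuousLinearMap.adjoint X u =
          inner ℂ u (ContinuousLinearMap.adjoint X u) • u := hcomm
        rw [← ContinuousLinearMap.adjoint_inner_left, hadj, inner_smul_left, (hmem x).mp hx u hu,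
          mul_zero])
    let e : H := (‖v‖⁻¹ : ℂ) • v
    have he1 : ‖e‖ = 1 := by
      rw [norm_smul, norm_inv, Complex.norm_real, norm_norm,
        inv_mul_cancel₀ (norm_ne_zero_iff.mpr hv0)]
    have heperp : e ∈ (Submodule.span ℂ w)ᗮ := Submodule.smul_mem _ _ hv
    have hins : insert e w ∈
        {s : Set H | Orthonormal ℂ ((↑) : s → H) ∧ ∀ v ∈ s, rankOne ℂ v v ∈ C} := by
      constructor
      · classical
        rw [orthonormal_subtype_iff_ite] at hwo ⊢
        have h1 : inner ℂ e e = (1 : ℂ) := by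
          rw [inner_self_eq_norm_sq_to_K, he1]
          simp
        have h2 : ∀ u ∈ w, inner ℂ u e = (0 : ℂ) := (hmem e).mp heperp
        have h3 : ∀ u ∈ w, u ≠ e := fun u hu h => by
          have := h2 u hu
          rw [h, h1] at this
          exact one_ne_zero this
        rintro x (rfl | hx) y (rfl | hy)
        · simpa using h1
        · rw [if_neg (h3 y hy).symm, inner_eq_zero_symm, h2 y hy]
        · rw [if_neg (h3 x hx), h2 x hx]
        · exact hwo x hx y hy
      · rintro u (rfl | hu)
        · refine hC.rankOne_mem_of_eigenvector (hrank _) fun X hX => ?_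
          obtain ⟨c, hc⟩ := hev X hX
          exact ⟨c, by rw [map_smul, hc, smul_comm]⟩
        · exact hwC u hu
    have hew : e ∈ w := hmax hins (Set.subset_insert e w) (Set.mem_insert e w)
    have h0 : inner ℂ e e = (0 : ℂ) := (hmem e).mp heperp e hew
    rw [inner_self_eq_zero] at h0
    simp [h0] at he1
  refine ⟨w, HilbertBasis.mkOfOrthogonalEqBot hwo hperp, fun i => ?_⟩
  rw [HilbertBasis.coe_mkOfOrthogonalEqBot]
  exact hwC i i.2

end IsCartan

end OperatorIdeal

/-! ### Matrix units from the normalizer -/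

namespace OperatorIdeal.IsCartan

open InnerProductSpace

variable {H : Type*} [NormedAddCommGroup H] [InnerProductSpace ℂ H] [CompleteSpace H]
  {I : TwoSidedIdeal (H →L[ℂ] H)} {C : NonUnitalStarSubalgebra ℂ (H →L[ℂ] H)}

/-- The reflection that swaps two orthonormal joint eigenvectors of a Cartan subalgebra belongs to
the normalizer. -/
theorem one_sub_rankOne_mem_normalizer (hC : IsCartan I C) {u v : H} (hu : ‖u‖ = 1) (hv : ‖v‖ = 1)
    (huv : inner ℂ u v = (0 : ℂ)) (huC : rankOne ℂ u u ∈ C) (hvC : rankOne ℂ v v ∈ C)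
    (hr : rankOne ℂ (u - v) (u - v) ∈ I) :
    1 - rankOne ℂ (u - v) (u - v) ∈ normalizer I C := by
  have huu : inner ℂ u u = (1 : ℂ) := by simp [inner_self_eq_norm_sq_to_K, hu]
  have hvv : inner ℂ v v = (1 : ℂ) := by simp [inner_self_eq_norm_sq_to_K, hv]
  have hvu : inner ℂ v u = (0 : ℂ) := inner_eq_zero_symm.mp huv
  -- Since `‖u - v‖ ^ 2 = 2`, this is the reflection in the hyperplane orthogonal to `u - v`.
  set W : H →L[ℂ] H := 1 - rankOne ℂ (u - v) (u - v) with hW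
  have hWs : star W = W := by
    rw [hW, star_sub, star_one]
    exact congrArg (1 - ·) (adjoint_rankOne _ _)
  have hWW : W * W = 1 := by
    ext z
    simp only [hW, mul_apply_eq_comp, sub_apply, one_apply_eq_self, rankOne_apply, inner_sub_left,
      inner_sub_right, inner_smul_right, huu, hvv, huv, hvu]
    module
  have hconj : ∀ D ∈ C, W * D * W ∈ C := by
    intro D hD
    have heig : ∀ x : H, inner ℂ x x = (1 : ℂ) → rankOne ℂ x x ∈ C →
        D x = inner ℂ x (D x) • x ∧ ∀ z, inner ℂ x (D z) = inner ℂ x (D x) * inner ℂ x z := by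
      intro x hx hxC
      have hcomm : ∀ z, inner ℂ x z • D x = inner ℂ x (D z) • x := fun z => by
        have h := congrArg (fun A : H →L[ℂ] H => A z) (hC.1.2 D hD _ hxC)
        simpa only [mul_apply_eq_comp, rankOne_apply, map_smul] using h
      refine ⟨by simpa only [hx, one_smul] using hcomm x, fun z => ?_⟩
      have h := congrArg (inner ℂ x) (hcomm z)
      rw [inner_smul_right, inner_smul_right, hx, mul_one] at h
      rw [← h, mul_comm]
    obtain ⟨hDu, hDu'⟩ := heig u huu huC
    obtain ⟨hDv, hDv'⟩ := heig v hvv hvC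
    generalize inner ℂ u (D u) = α at hDu hDu'
    generalize inner ℂ v (D v) = β at hDv hDv'
    -- Conjugation only exchanges the eigenvalues `α` and `β` of `D` at `u` and `v`.
    have hEq : W * D * W = D + (β - α) • (rankOne ℂ u u - rankOne ℂ v v) := by
      ext z
      simp only [hW, mul_apply_eq_comp, sub_apply, add_apply, smul_apply, one_apply_eq_self,
        rankOne_apply, map_sub, map_smul, hDu, hDv, hDu', hDv', huu, hvv, huv, hvu]
      module
    rw [hEq]
    exact add_mem hD (SMulMemClass.smul_mem _ (sub_mem huC hvC))
  refine ⟨⟨Unitary.mem_iff.mpr ⟨by rw [hWs, hWW], by rw [hWs, hWW]⟩, ?_⟩, ?_⟩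
  · rw [hW, sub_sub_cancel_left]
    exact I.neg_mem hr
  · ext X
    simp only [hWs]
    constructor
    · rintro ⟨D, hD, rfl⟩
      exact hconj D hD
    · intro hX
      refine ⟨W * X * W, hconj X hX, ?_⟩
      calc W * (W * X * W) * W = W * W * X * (W * W) := by noncomm_ring
        _ = X := by rw [hWW, one_mul, mul_one]

/-- The matrix unit given by two orthonormal joint eigenvectors of a Cartan subalgebra is the
product of an element of the normalizer and an element of the Cartan subalgebra. -/
theorem exists_normalizer_mul_eq_rankOne (hC : IsCartan I C) {u v : H} (hu : ‖u‖ = 1)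
    (hv : ‖v‖ = 1) (huv : u = v ∨ inner ℂ u v = (0 : ℂ)) (huC : rankOne ℂ u u ∈ C)
    (hvC : rankOne ℂ v v ∈ C) (hr : rankOne ℂ (u - v) (u - v) ∈ I) :
    ∃ W ∈ normalizer I C, ∃ D ∈ C, rankOne ℂ u v = W * D := by
  rcases huv with rfl | huv
  · refine ⟨1, ⟨⟨one_mem _, ?_⟩, ?_⟩, _, huC, (one_mul _).symm⟩
    · rw [sub_self]
      exact zero_mem _
    · simp
  -- The reflection sends `v` to `u`, hence `rankOne ℂ v v` to `rankOne ℂ u v`.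
  · refine ⟨_, hC.one_sub_rankOne_mem_normalizer hu hv huv huC hvC hr, _, hvC, ?_⟩
    have hvv : inner ℂ v v = (1 : ℂ) := by simp [inner_self_eq_norm_sq_to_K, hv]
    ext z
    simp only [mul_apply_eq_comp, sub_apply, one_apply_eq_self, rankOne_apply, inner_sub_left,
      inner_smul_right, huv, hvv]
    module

end OperatorIdeal.IsCartan

theorem theorem4p4 {H : Type*} [NormedAddCommGroup H] [InnerProductSpace ℂ H] [CompleteSpace H]
    [TopologicalSpace.SeparableSpace H] (hH : ¬ FiniteDimensional ℂ H)
    (I : OperatorIdeal.NormedIdeal H) (hI_bot : I.ideal ≠ ⊥) (hI_top : I.ideal ≠ ⊤)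
    [CompleteSpace I.Elem] [TopologicalSpace.SeparableSpace I.Elem]
    (C : NonUnitalStarSubalgebra ℂ (H →L[ℂ] H)) (hC : OperatorIdeal.IsCartan I.ideal C) :
    Dense (Submodule.span ℂ
      {X : I.Elem | ∃ W ∈ OperatorIdeal.normalizer I.ideal C, ∃ D ∈ C, X.toOp = W * D} :
        Set I.Elem) := by
  obtain ⟨w, b, hb⟩ := hC.exists_hilbertBasis
    (fun X hX => OperatorIdeal.NormedIdeal.isCompactOperator_toOp hH hI_bot (I.ofMem X hX))
    (fun v => OperatorIdeal.NormedIdeal.rankOne_mem hI_bot v v)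
  have := b.orthonormal.countable
  have := b.infinite_index hH
  refine OperatorIdeal.NormedIdeal.dense_span_of_rankOne_mem b _
    (fun i j S hS => Submodule.subset_span ?_) hI_bot
  have hij : b i = b j ∨ inner ℂ (b i) (b j) = (0 : ℂ) := by
    rcases eq_or_ne i j with h | h
    · exact Or.inl (congrArg b h)
    · exact Or.inr (b.orthonormal.inner_eq_zero h)
  obtain ⟨W, hW, D, hD, h⟩ := hC.exists_normalizer_mul_eq_rankOne (b.orthonormal.norm_eq_one i)
    (b.orthonormal.norm_eq_one j) hij (hb i) (hb j)
    (OperatorIdeal.NormedIdeal.rankOne_mem hI_bot _ _)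
  exact ⟨W, hW, D, hD, hS.trans h⟩
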